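/- Let $\mathbb{T}=\mathbb{R}/\mathbb{Z}$ be the circle with Lebesgue measure $m$ normalized so that $m(\mathbb{T})=1$; write $|A|=m(A)$, and say that $A$ is almost contained in $B$ if $|A\setminus B|=0$. An interval of $\mathbb{T}$ is an arc with or without its endpoints ($\mathbb{T}$ itself included). Let $h$ be a measure function, i.e. a function on $[0,1]$ that is continuous and increasing with $h(0)=0$, such that $t\mapsto h(t)/t$ is decreasing on $(0,1]$ and $\lim_{t\to0^+}h(t)/t=+\infty$. A closed set $A\subseteq\mathbb{T}$ is called $h$-Carleson if the disjoint open arcs $\ell_n$ which constitute $\mathbb{T}\setminus A$ satisfy $\sum_n h(|\ell_n|)<\infty$. Let $E\subseteq\mathbb{T}$ be measurable, and let $E=(\mathrm{res}_h(E)\cup\mathrm{core}_h(E))\setminus N$ be its core-residual decomposition, i.e. $|N|=0$, $\mathrm{res}_h(E)$ and $\mathrm{core}_h(E)$ are disjoint and measurable, every $h$-Carleson set almost contained in $E$ is almost contained in $\mathrm{core}_h(E)$, and $\mathrm{core}_h(E)$ is, up to a set of measure zero, a countable union of $h$-Carleson sets almost contained in $E$. (Such a decomposition exists and is unique up to sets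 of measure zero; the statement holds for every choice of representatives.) Then there exists a sequence $\{f_n\}_n$ of real-valued bounded measurable functions on $\mathbb{T}$ such that (i) $\int_\Delta f_n\,dm\le 2h(|\Delta|)$ for every $n$ and every interval $\Delta$ of $\mathbb{T}$; (ii) $\int_{\mathbb{T}} f_n\,dm=0$ for every $n$; (iii) for every $n$, $f_n(x)=0$ for almost every $x\in\mathrm{core}_h(E)$; (iv) for every $n$, $f_n(x)\le 0$ for almost every $x\in\mathrm{res}_h(E)$; (v) there is a set $Z$ of measure zero such that $f_n(x)\to-\infty$ as $n\to\infty$, uniformly for $x\in\mathrm{res}_h(E)\setminus Z$. -/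

import Mathlib

open Set Filter Topology MeasureTheory

/-- A measure function: continuous and increasing with `h 0 = 0`, and `h t / t` decreasing with
`h t / t → ∞` as `t → 0+`. Only the values on `[0, 1]` matter, as the total length of the circle
is `1`. -/
structure IsMeasureFunction (h : ℝ → ℝ) : Prop where
  continuousOn : ContinuousOn h (Icc 0 1)
  monotoneOn : MonotoneOn h (Icc 0 1)
  map_zero : h 0 = 0
  antitoneOn_div : AntitoneOn (fun t => h t / t) (Ioc 0 1)
  tendsto_div : Tendsto (fun t => h t / t) (𝓝[>] 0) atTop

/-- An interval (arc) of the circle `𝕋 = ℝ / ℤ`: the image of a bounded real interval of length at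
most `1`, with or without each of its endpoints. The whole circle is an arc of length `1`. -/
def IsArc (Δ : Set UnitAddCircle) : Prop :=
  ∃ (a b : ℝ) (J : Set ℝ), a ≤ b ∧ b ≤ a + 1 ∧ Ioo a b ⊆ J ∧ J ⊆ Icc a b ∧
    Δ = (fun t : ℝ => (t : UnitAddCircle)) '' J

/-- A closed set `A` is `h`-Carleson if the disjoint open arcs `ℓ` which constitute its complement
satisfy `∑ h(|ℓ|) < ∞`. -/
def IsHCarleson (h : ℝ → ℝ) (A : Set UnitAddCircle) : Prop :=
  IsClosed A ∧ ∃ L : Set (Set UnitAddCircle),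
    (∀ ℓ ∈ L, IsOpen ℓ ∧ IsArc ℓ) ∧ L.PairwiseDisjoint id ∧ ⋃₀ L = Aᶜ ∧
    Summable (fun ℓ : L => h (volume.real (ℓ : Set UnitAddCircle)))

/-- `A` is almost contained in `B`. -/
def AlmostContained (A B : Set UnitAddCircle) : Prop := volume (A \ B) = 0

/-- `core` and `res` form the core-residual decomposition of `E` with respect to `h` (the two sets
are determined by `E` and `h` up to null sets, and any representatives are allowed). -/
structure IsCoreResidual (h : ℝ → ℝ) (E core res : Set UnitAddCircle) : Prop where
  measurable_core : NullMeasurableSet core volume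
  measurable_res : NullMeasurableSet res volume
  disjoint : Disjoint res core
  decomp : ∃ N : Set UnitAddCircle, volume N = 0 ∧ E = (res ∪ core) \ N
  carleson_subset : ∀ A, IsHCarleson h A → AlmostContained A E → AlmostContained A core
  core_eq : ∃ G : ℕ → Set UnitAddCircle,
    (∀ n, IsHCarleson h (G n) ∧ AlmostContained (G n) E) ∧ core =ᵐ[volume] ⋃ n, G n

theorem isHCarleson_empty (h : ℝ → ℝ) : IsHCarleson h ∅ := by
  refine ⟨isClosed_empty, {univ}, ?_, pairwiseDisjoint_singleton _ _, by simp, ?_⟩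
  · rintro ℓ rfl
    refine ⟨isOpen_univ, 0, 1, Icc 0 1, by norm_num, by norm_num, Ioo_subset_Icc_self, le_rfl, ?_⟩
    have := AddCircle.coe_image_Icc_eq (1 : ℝ) 0
    simpa using this.symm
  · exact (hasSum_fintype _).summable

/-- Every measurable set has a core-residual decomposition. -/
theorem exists_isCoreResidual (h : ℝ → ℝ) {E : Set UnitAddCircle}
    (hE : NullMeasurableSet E volume) : ∃ core res, IsCoreResidual h E core res := by
  let S : Set (ℕ → Set UnitAddCircle) := {G | ∀ n, IsHCarleson h (G n) ∧ AlmostContained (G n) E}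
  let m : (ℕ → Set UnitAddCircle) → ENNReal := fun G => volume (⋃ n, G n)
  have hS : S.Nonempty := ⟨fun _ => ∅, fun _ => ⟨isHCarleson_empty h, by simp [AlmostContained]⟩⟩
  obtain ⟨u, -, hu, huS⟩ := exists_seq_tendsto_sSup (hS.image m) (OrderTop.bddAbove _)
  choose V hVS hVu using huS
  let G : ℕ → Set UnitAddCircle := fun k => V k.unpair.1 k.unpair.2
  have hG : ∀ n, IsHCarleson h (G n) ∧ AlmostContained (G n) E := fun n => hVS _ _
  have hsub : ∀ k, (⋃ n, V k n) ⊆ ⋃ n, G n := by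
    intro k
    refine iUnion_subset fun n => ?_
    have : G (Nat.pair k n) = V k n := by simp [G]
    rw [← this]
    exact subset_iUnion G _
  have hle : sSup (m '' S) ≤ volume (⋃ n, G n) :=
    le_of_tendsto' hu fun k => (hVu k) ▸ measure_mono (hsub k)
  have hmeas : MeasurableSet (⋃ n, G n) := MeasurableSet.iUnion fun n => (hG n).1.1.measurableSet
  refine ⟨⋃ n, G n, E \ ⋃ n, G n, hmeas.nullMeasurableSet, hE.diff hmeas.nullMeasurableSet,
    disjoint_sdiff_left, ⟨(⋃ n, G n) \ E, ?_, ?_⟩, ?_, G, hG, EventuallyEq.rfl⟩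
  · rw [iUnion_sdiff]
    exact measure_iUnion_null fun n => (hG n).2
  · ext x
    simp only [Set.mem_sdiff, mem_union]
    tauto
  · intro A hA hAE
    let G' : ℕ → Set UnitAddCircle := fun n => Nat.casesOn n A G
    have hG'S : G' ∈ S := by
      intro n
      cases n with
      | zero => exact ⟨hA, hAE⟩
      | succ n => exact hG n
    have hU : (⋃ n, G' n) = (A \ ⋃ n, G n) ∪ ⋃ n, G n := by
      rw [sdiff_union_self]
      ext x
      simp only [mem_iUnion, mem_union]
      constructor
      · rintro ⟨n, hn⟩
        cases n with
        | zero => exact Or.inl hn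
        | succ n => exact Or.inr ⟨n, hn⟩
      · rintro (hx | ⟨n, hn⟩)
        · exact ⟨0, hx⟩
        · exact ⟨n + 1, hn⟩
    have h1 : volume (⋃ n, G' n) ≤ volume (⋃ n, G n) :=
      (le_sSup (mem_image_of_mem m hG'S)).trans hle
    rw [hU, measure_union disjoint_sdiff_left hmeas] at h1
    have hfin : volume (⋃ n, G n) ≠ ⊤ := measure_ne_top _ _
    have h2 : volume (A \ ⋃ n, G n) + volume (⋃ n, G n) ≤ 0 + volume (⋃ n, G n) := by
      simpa using h1
    exact le_antisymm ((ENNReal.add_le_add_iff_right hfin).1 h2) zero_le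

open scoped ENNReal NNReal symmDiff

/-!
Let `R` be the residual part, `P` the complement of `E`, both viewed in `[0, 1]`, and fix `c ≥ 0`.
Paying for a step from `x` to `y` either `M |P ∩ (x, y]|` or `h (y - x) + c |R ∩ (x, y]|`, whichever
is cheaper, let `G y` be the least cost of travelling from `0` to `y`. Both bounds hold for the
increments of the monotone function `G`, so `G' = 0` off `P`, and `f = θ G' - c 1_R` has
`∫ f ≤ h` on intervals and total integral `0` for a suitable `θ ∈ [0, 1]`, provided that
`G 1 ≥ c |R|`.

This last inequality amounts to `c |R \ U| ≤ ∑ h(|I|) + M |P \ U|` for every finite union `U` of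
disjoint intervals `I`, which holds once `M` is large. Otherwise there are counterexamples `U` with
`|P \ U| → 0` and bounded `∑ h(|I|)`. Since `h t / t → ∞`, short intervals carry little of the total
length, so `U` converges in measure along a subsequence to an open set whose complement is an
`h`-Carleson set almost disjoint from `P`, hence from `R`. Therefore `|R \ U| → 0`, the failing
inequality forces `∑ h(|I|) → 0` and with it `|U| → 0`, and `R` is null: then nothing fails.

The factor `2` in the theorem appears because an arc through `0` is cut into two intervals.
-/

section MeasureFunction

variable {h : ℝ → ℝ}

theorem exists_pos_forall_ofReal_le_mul (hdiv : Tendsto (fun t => h t / t) (𝓝[>] 0) atTop)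
    {η : ℝ≥0∞} (hη : η ≠ 0) :
    ∃ δ > 0, ∀ t ≤ δ, ENNReal.ofReal t ≤ η * ENNReal.ofReal (h t) := by
  obtain ⟨r, hr, hrη⟩ := ENNReal.lt_iff_exists_nnreal_btwn.1 (pos_iff_ne_zero.2 hη)
  have hr0 : (0 : ℝ) < r := by exact_mod_cast hr
  obtain ⟨u, hu, hsub⟩ := mem_nhdsGT_iff_exists_Ioc_subset.1 (hdiv.eventually_ge_atTop (r : ℝ)⁻¹)
  refine ⟨u, hu, fun t htu => ?_⟩
  rcases le_or_gt t 0 with ht | ht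
  · simp [ENNReal.ofReal_of_nonpos ht]
  have hslope : (r : ℝ)⁻¹ ≤ h t / t := hsub ⟨ht, htu⟩
  have hle : t ≤ r * h t := by
    rwa [le_div_iff₀ ht, inv_mul_le_iff₀ hr0] at hslope
  calc ENNReal.ofReal t ≤ ENNReal.ofReal (r * h t) := ENNReal.ofReal_le_ofReal hle
    _ = r * ENNReal.ofReal (h t) := by
        rw [ENNReal.ofReal_mul r.coe_nonneg, ENNReal.ofReal_coe_nnreal]
    _ ≤ η * ENNReal.ofReal (h t) := by gcongr

theorem exists_forall_ofReal_le_mul_of_le_one (hmono : Monotone h)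
    (hdiv : Tendsto (fun t => h t / t) (𝓝[>] 0) atTop) :
    ∃ C : ℝ≥0∞, C ≠ ⊤ ∧ ∀ t ≤ 1, ENNReal.ofReal t ≤ C * ENNReal.ofReal (h t) := by
  obtain ⟨δ, hδ, hsmall⟩ := exists_pos_forall_ofReal_le_mul hdiv one_ne_zero
  have hhδ : ENNReal.ofReal (h δ) ≠ 0 :=
    ((ENNReal.ofReal_pos.2 hδ).trans_le ((hsmall δ le_rfl).trans_eq (one_mul _))).ne'
  refine ⟨max 1 (ENNReal.ofReal (h δ))⁻¹, by simp [hhδ], fun t ht => ?_⟩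
  rcases le_total t δ with htδ | htδ
  · exact (hsmall t htδ).trans (by gcongr; exact le_max_left _ _)
  calc ENNReal.ofReal t ≤ 1 := by simpa using ht
    _ = (ENNReal.ofReal (h δ))⁻¹ * ENNReal.ofReal (h δ) :=
      (ENNReal.inv_mul_cancel hhδ ENNReal.ofReal_ne_top).symm
    _ ≤ max 1 (ENNReal.ofReal (h δ))⁻¹ * ENNReal.ofReal (h t) := by
      gcongr
      · exact le_max_right _ _
      · exact hmono htδ

theorem exists_forall_tsum_ofReal_nat_add_le (hmono : Monotone h)
    (hdiv : Tendsto (fun t => h t / t) (𝓝[>] 0) atTop) {c ε : ℝ≥0∞} (hc : c ≠ ⊤) (hε : ε ≠ 0) :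
    ∃ K : ℕ, ∀ l : ℕ → ℝ, Antitone l → ∑' k, ENNReal.ofReal (h (l k)) ≤ c →
      ∑' k, ENNReal.ofReal (l (k + K)) ≤ ε := by
  obtain ⟨η, hη, hηε⟩ := ENNReal.exists_nnreal_pos_mul_lt hc hε
  obtain ⟨δ, hδ, hsmall⟩ :=
    exists_pos_forall_ofReal_le_mul hdiv (ENNReal.coe_ne_zero.2 (ne_of_gt hη))
  have hhδ : ENNReal.ofReal (h δ) ≠ 0 := fun h0 => by
    simpa [h0, hδ.not_ge] using hsmall δ le_rfl
  obtain ⟨K, hK⟩ := ENNReal.exists_nat_mul_gt hhδ hc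
  refine ⟨K, fun l hl hsum => ?_⟩
  have hlK : l K ≤ δ := by
    by_contra! hlt
    refine hK.not_ge (le_trans ?_ hsum)
    calc K * ENNReal.ofReal (h δ) = ∑ _k ∈ Finset.range K, ENNReal.ofReal (h δ) := by simp
      _ ≤ ∑ k ∈ Finset.range K, ENNReal.ofReal (h (l k)) := by
        gcongr with k hk
        exact hmono (hlt.le.trans (hl (Finset.mem_range.1 hk).le))
      _ ≤ ∑' k, ENNReal.ofReal (h (l k)) := ENNReal.sum_le_tsum _
  calc ∑' k, ENNReal.ofReal (l (k + K))
      ≤ ∑' k, η * ENNReal.ofReal (h (l (k + K))) :=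
        ENNReal.tsum_le_tsum fun k => hsmall _ ((hl le_add_self).trans hlK)
    _ = η * ∑' k, ENNReal.ofReal (h (l (k + K))) := ENNReal.tsum_mul_left
    _ ≤ η * ∑' k, ENNReal.ofReal (h (l k)) := by
        gcongr η * ?_
        exact ENNReal.tsum_comp_le_tsum_of_injective (add_left_injective K) _
    _ ≤ ε := (by gcongr : _ ≤ η * c).trans hηε.le

end MeasureFunction

section GapFamily

/-- A sequence of disjoint open subintervals `((I k).1, (I k).2)` of `[0, 1]`, encoded by their
endpoints; padding by empty intervals makes finite families special cases. The complements of
such families are the Carleson sets when `∑ h (length)` converges. -/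
structure IsGapFamily (I : ℕ → ℝ × ℝ) : Prop where
  nonneg_fst : ∀ k, 0 ≤ (I k).1
  fst_le_snd : ∀ k, (I k).1 ≤ (I k).2
  snd_le_one : ∀ k, (I k).2 ≤ 1
  disjoint : Pairwise fun i j => Disjoint (Ioo (I i).1 (I i).2) (Ioo (I j).1 (I j).2)

/-- The union of the open intervals of a family given by endpoints. -/
def gapUnion (I : ℕ → ℝ × ℝ) : Set ℝ := ⋃ k, Ioo (I k).1 (I k).2

/-- The length of the `k`-th interval of a family given by endpoints. -/
def gapLength (I : ℕ → ℝ × ℝ) (k : ℕ) : ℝ := (I k).2 - (I k).1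

/-- The Carleson sum `∑ h (length)` of a family of intervals, with values in `[0, ∞]`; negative
values of `h` count as `0`. -/
noncomputable def gapSum (h : ℝ → ℝ) (I : ℕ → ℝ × ℝ) : ℝ≥0∞ :=
  ∑' k, ENNReal.ofReal (h (gapLength I k))

variable {h : ℝ → ℝ} {I : ℕ → ℝ × ℝ}

theorem IsGapFamily.gapLength_nonneg (hI : IsGapFamily I) (k : ℕ) : 0 ≤ gapLength I k :=
  sub_nonneg.2 (hI.fst_le_snd k)

theorem IsGapFamily.gapLength_le_one (hI : IsGapFamily I) (k : ℕ) : gapLength I k ≤ 1 :=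
  (sub_le_self _ (hI.nonneg_fst k)).trans (hI.snd_le_one k)

theorem IsGapFamily.comp_perm (hI : IsGapFamily I) (σ : Equiv.Perm ℕ) : IsGapFamily (I ∘ σ) where
  nonneg_fst k := hI.nonneg_fst (σ k)
  fst_le_snd k := hI.fst_le_snd (σ k)
  snd_le_one k := hI.snd_le_one (σ k)
  disjoint _ _ hij := hI.disjoint (σ.injective.ne hij)

theorem gapUnion_comp_perm (I : ℕ → ℝ × ℝ) (σ : Equiv.Perm ℕ) : gapUnion (I ∘ σ) = gapUnion I :=
  σ.surjective.iUnion_comp fun k => Ioo (I k).1 (I k).2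

theorem gapSum_comp_perm (h : ℝ → ℝ) (I : ℕ → ℝ × ℝ) (σ : Equiv.Perm ℕ) :
    gapSum h (I ∘ σ) = gapSum h I :=
  σ.tsum_eq fun k => ENNReal.ofReal (h (gapLength I k))

theorem volume_gapUnion_le (I : ℕ → ℝ × ℝ) :
    volume (gapUnion I) ≤ ∑' k, ENNReal.ofReal (gapLength I k) :=
  (measure_iUnion_le _).trans_eq (by simp only [Real.volume_Ioo, gapLength])

theorem IsGapFamily.volume_gapUnion_le_mul (hI : IsGapFamily I) {C : ℝ≥0∞}
    (hC : ∀ t ≤ 1, ENNReal.ofReal t ≤ C * ENNReal.ofReal (h t)) :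
    volume (gapUnion I) ≤ C * gapSum h I :=
  calc volume (gapUnion I) ≤ ∑' k, ENNReal.ofReal (gapLength I k) := volume_gapUnion_le I
    _ ≤ ∑' k, C * ENNReal.ofReal (h (gapLength I k)) :=
      ENNReal.tsum_le_tsum fun k => hC _ (hI.gapLength_le_one k)
    _ = C * gapSum h I := ENNReal.tsum_mul_left

theorem exists_perm_antitone_comp {l : ℕ → ℝ} (hl : 0 ≤ l) (hfin : l.support.Finite) :
    ∃ σ : Equiv.Perm ℕ, Antitone (l ∘ σ) := by
  obtain ⟨n, hn⟩ := hfin.bddAbove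
  have hzero : ∀ k ≥ n + 1, l k = 0 := fun k hk => by
    by_contra hne
    exact absurd (hn hne) (by omega)
  let l' : Fin (n + 1) → ℝ := fun i => l i
  let τ := Tuple.sort (-l')
  have hτ : Antitone (l' ∘ τ) := fun i j hij => neg_le_neg_iff.1 (Tuple.monotone_sort (-l') hij)
  refine ⟨τ.extendDomain Fin.equivSubtype, fun i j hij => ?_⟩
  rcases lt_or_ge j (n + 1) with hj | hj
  · have happly : ∀ k (hk : k < n + 1),
        (l ∘ τ.extendDomain Fin.equivSubtype) k = (l' ∘ τ) ⟨k, hk⟩ := fun k hk => by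
      rw [Function.comp_apply, Equiv.Perm.extendDomain_apply_subtype τ Fin.equivSubtype hk]
      rfl
    rw [happly i (hij.trans_lt hj), happly j hj]
    exact hτ hij
  · rw [Function.comp_apply, Equiv.Perm.extendDomain_apply_not_subtype τ Fin.equivSubtype
      (not_lt.2 hj), hzero j hj]
    exact hl _

end GapFamily

section Compactness

variable {h : ℝ → ℝ} {c : ℝ≥0∞}

/-- The gap families with Carleson sum at most `c`, listed by decreasing length. The ordering makes
the tails of the total length uniformly small, which is what compactness rests on. -/
def sortedGapFamilies (h : ℝ → ℝ) (c : ℝ≥0∞) : Set (ℕ → ℝ × ℝ) :=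
  {I | IsGapFamily I ∧ Antitone (gapLength I) ∧ gapSum h I ≤ c}

theorem continuous_gapLength (k : ℕ) : Continuous fun I : ℕ → ℝ × ℝ => gapLength I k := by
  unfold gapLength
  fun_prop

theorem lowerSemicontinuous_gapSum (hlsc : LowerSemicontinuous h) :
    LowerSemicontinuous (gapSum h) :=
  lowerSemicontinuous_tsum fun k =>
    ENNReal.continuous_ofReal.comp_lowerSemicontinuous (hlsc.comp (continuous_gapLength k))
      fun _ _ => ENNReal.ofReal_le_ofReal

theorem isCompact_setOf_isGapFamily : IsCompact {I : ℕ → ℝ × ℝ | IsGapFamily I} := by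
  have hcompact : IsCompact (univ.pi fun _ : ℕ => Icc (0 : ℝ) 1 ×ˢ Icc (0 : ℝ) 1) :=
    isCompact_univ_pi fun _ => isCompact_Icc.prod isCompact_Icc
  have heq : {I : ℕ → ℝ × ℝ | IsGapFamily I} =
      {I | (∀ k, 0 ≤ (I k).1) ∧ (∀ k, (I k).1 ≤ (I k).2) ∧ (∀ k, (I k).2 ≤ 1) ∧
        ∀ i j, i ≠ j → min (I i).2 (I j).2 ≤ max (I i).1 (I j).1} := by
    ext I
    exact ⟨fun hI => ⟨hI.1, hI.2, hI.3, fun i j hij => Ioo_disjoint_Ioo.1 (hI.4 hij)⟩,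
      fun hI => ⟨hI.1, hI.2.1, hI.2.2.1, fun i j hij => Ioo_disjoint_Ioo.2 (hI.2.2.2 i j hij)⟩⟩
  refine hcompact.of_isClosed_subset ?_ fun I (hI : IsGapFamily I) k _ =>
    ⟨⟨hI.nonneg_fst k, (hI.fst_le_snd k).trans (hI.snd_le_one k)⟩,
      (hI.nonneg_fst k).trans (hI.fst_le_snd k), hI.snd_le_one k⟩
  rw [heq]
  simp only [ofPred_and, ofPred_forall]
  refine .inter ?_ (.inter ?_ (.inter ?_ ?_))
  · exact isClosed_iInter fun k => isClosed_le (by fun_prop) (by fun_prop)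
  · exact isClosed_iInter fun k => isClosed_le (by fun_prop) (by fun_prop)
  · exact isClosed_iInter fun k => isClosed_le (by fun_prop) (by fun_prop)
  · exact isClosed_iInter fun i => isClosed_iInter fun j => isClosed_iInter fun _ =>
      isClosed_le (by fun_prop) (by fun_prop)

theorem isCompact_sortedGapFamilies (hlsc : LowerSemicontinuous h) (c : ℝ≥0∞) :
    IsCompact (sortedGapFamilies h c) := by
  have hanti : IsClosed {I : ℕ → ℝ × ℝ | Antitone (gapLength I)} := by
    simp only [Antitone, ofPred_forall]
    exact isClosed_iInter fun i => isClosed_iInter fun j => isClosed_iInter fun _ =>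
      isClosed_le (continuous_gapLength j) (continuous_gapLength i)
  exact isCompact_setOf_isGapFamily.inter_right
    (hanti.inter ((lowerSemicontinuous_gapSum hlsc).isClosed_preimage c))

theorem Ioo_symmDiff_Ioo_subset {α : Type*} [LinearOrder α] (a b a' b' : α) :
    Ioo a b ∆ Ioo a' b' ⊆ uIcc a a' ∪ uIcc b b' := by
  intro x hx
  simp only [mem_symmDiff, mem_Ioo, mem_union, mem_uIcc] at hx ⊢
  grind

theorem tendsto_volume_Ioo_symmDiff {ι : Type*} {f : Filter ι} {p : ι → ℝ × ℝ} {q : ℝ × ℝ}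
    (hp : Tendsto p f (𝓝 q)) :
    Tendsto (fun i => volume (Ioo (p i).1 (p i).2 ∆ Ioo q.1 q.2)) f (𝓝 0) := by
  have hbound : Tendsto (fun i => ENNReal.ofReal |q.1 - (p i).1| + ENNReal.ofReal |q.2 - (p i).2|)
      f (𝓝 0) := by
    have hcont : Continuous fun r : ℝ × ℝ =>
        ENNReal.ofReal |q.1 - r.1| + ENNReal.ofReal |q.2 - r.2| :=
      (ENNReal.continuous_ofReal.comp (by fun_prop)).add
        (ENNReal.continuous_ofReal.comp (by fun_prop))
    simpa [Function.comp_def] using (hcont.tendsto q).comp hp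
  refine tendsto_of_tendsto_of_tendsto_of_le_of_le tendsto_const_nhds hbound (fun _ => zero_le)
    fun i => ?_
  calc volume (Ioo (p i).1 (p i).2 ∆ Ioo q.1 q.2)
      ≤ volume (uIcc (p i).1 q.1 ∪ uIcc (p i).2 q.2) :=
        measure_mono (Ioo_symmDiff_Ioo_subset _ _ _ _)
    _ ≤ volume (uIcc (p i).1 q.1) + volume (uIcc (p i).2 q.2) := measure_union_le _ _
    _ = _ := by simp only [Real.volume_interval]

theorem volume_gapUnion_symmDiff_le (I J : ℕ → ℝ × ℝ) (K : ℕ) :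
    volume (gapUnion I ∆ gapUnion J) ≤
      ∑ k ∈ Finset.range K, volume (Ioo (I k).1 (I k).2 ∆ Ioo (J k).1 (J k).2) +
        (∑' k, ENNReal.ofReal (gapLength I (k + K)) +
          ∑' k, ENNReal.ofReal (gapLength J (k + K))) := by
  let d : ℕ → ℝ≥0∞ := fun k => volume (Ioo (I k).1 (I k).2 ∆ Ioo (J k).1 (J k).2)
  have hd : ∀ k, d k ≤ ENNReal.ofReal (gapLength I k) + ENNReal.ofReal (gapLength J k) := by
    intro k
    simpa only [Real.volume_Ioo, gapLength] using
      (measure_mono (μ := volume) symmDiff_le_sup).trans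
        (measure_union_le (Ioo (I k).1 (I k).2) (Ioo (J k).1 (J k).2))
  calc volume (gapUnion I ∆ gapUnion J)
      ≤ ∑' k, d k := (measure_mono iUnion_symmDiff_iUnion_subset).trans (measure_iUnion_le _)
    _ = ∑ k ∈ Finset.range K, d k + ∑' k, d (k + K) :=
      (ENNReal.summable.sum_add_tsum_nat_add' (k := K)).symm
    _ ≤ _ := by
      rw [← ENNReal.tsum_add]
      gcongr with k
      exact hd _

theorem tendsto_volume_gapUnion_symmDiff (hmono : Monotone h)
    (hdiv : Tendsto (fun t => h t / t) (𝓝[>] 0) atTop) (hc : c ≠ ⊤) {ι : Type*} {f : Filter ι}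
    {I : ι → ℕ → ℝ × ℝ} {J : ℕ → ℝ × ℝ} (hI : ∀ i, I i ∈ sortedGapFamilies h c)
    (hJ : J ∈ sortedGapFamilies h c) (hIJ : Tendsto I f (𝓝 J)) :
    Tendsto (fun i => volume (gapUnion (I i) ∆ gapUnion J)) f (𝓝 0) := by
  refine ENNReal.tendsto_nhds_zero.2 fun ε hε => ?_
  have hε3 : 0 < ε / 3 := ENNReal.div_pos hε.ne' (by norm_num)
  obtain ⟨K, hK⟩ := exists_forall_tsum_ofReal_nat_add_le hmono hdiv hc hε3.ne'
  have hhead : Tendsto (fun i => ∑ k ∈ Finset.range K,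
      volume (Ioo (I i k).1 (I i k).2 ∆ Ioo (J k).1 (J k).2)) f (𝓝 0) := by
    simpa using tendsto_finsetSum (Finset.range K) fun k _ =>
      tendsto_volume_Ioo_symmDiff ((tendsto_pi_nhds.1 hIJ) k)
  filter_upwards [ENNReal.tendsto_nhds_zero.1 hhead _ hε3] with i hi
  calc volume (gapUnion (I i) ∆ gapUnion J)
      ≤ ε / 3 + (ε / 3 + ε / 3) := (volume_gapUnion_symmDiff_le _ _ K).trans <| by
        gcongr
        · exact hK _ (hI i).2.1 (hI i).2.2
        · exact hK _ hJ.2.1 hJ.2.2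
    _ = ε := by rw [← add_assoc, ENNReal.add_thirds]

end Compactness

section ExactPenalty

variable {h : ℝ → ℝ} {P R : Set ℝ}

theorem measure_sdiff_le_add_symmDiff {α : Type*} {m : MeasurableSpace α} (μ : Measure α)
    (S U V : Set α) : μ (S \ U) ≤ μ (S \ V) + μ (U ∆ V) := by
  refine (measure_mono fun x hx => ?_).trans (measure_union_le _ _)
  simp only [mem_union, Set.mem_sdiff, mem_symmDiff] at hx ⊢
  tauto

theorem exists_subseq_tendsto_volume_sdiff_gapUnion (hmono : Monotone h)
    (hlsc : LowerSemicontinuous h) (hdiv : Tendsto (fun t => h t / t) (𝓝[>] 0) atTop)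
    (H : ∀ I, IsGapFamily I → gapSum h I ≠ ⊤ → volume (P \ gapUnion I) = 0 →
      volume (R \ gapUnion I) = 0)
    {c : ℝ≥0∞} (hc : c ≠ ⊤) {I : ℕ → ℕ → ℝ × ℝ} (hI : ∀ m, IsGapFamily (I m))
    (hfin : ∀ m, (gapLength (I m)).support.Finite) (hsum : ∀ m, gapSum h (I m) ≤ c)
    (hP : Tendsto (fun m => volume (P \ gapUnion (I m))) atTop (𝓝 0)) :
    ∃ φ : ℕ → ℕ, StrictMono φ ∧
      Tendsto (fun m => volume (R \ gapUnion (I (φ m)))) atTop (𝓝 0) := by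
  choose σ hσ using fun m => exists_perm_antitone_comp (hI m).gapLength_nonneg (hfin m)
  have hsorted : ∀ m, I m ∘ σ m ∈ sortedGapFamilies h c := fun m =>
    ⟨(hI m).comp_perm _, hσ m, (gapSum_comp_perm h (I m) (σ m)).trans_le (hsum m)⟩
  obtain ⟨J, hJ, φ, hφ, hlim⟩ := (isCompact_sortedGapFamilies hlsc c).tendsto_subseq hsorted
  have hsymm : Tendsto (fun m => volume (gapUnion (I (φ m)) ∆ gapUnion J)) atTop (𝓝 0) := by
    simpa only [Function.comp_apply, gapUnion_comp_perm] using
      tendsto_volume_gapUnion_symmDiff hmono hdiv hc (fun m => hsorted (φ m)) hJ hlim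
  have hPJ : volume (P \ gapUnion J) = 0 := by
    refine le_antisymm (ge_of_tendsto' (x := atTop) ?_ fun m =>
      measure_sdiff_le_add_symmDiff volume P (gapUnion J) (gapUnion (I (φ m)))) zero_le
    simpa only [zero_add, symmDiff_comm, Function.comp_def] using
      (hP.comp hφ.tendsto_atTop).add hsymm
  have hRJ : volume (R \ gapUnion J) = 0 := H J hJ.1 (ne_top_of_le_ne_top hc hJ.2.2) hPJ
  refine ⟨φ, hφ, tendsto_of_tendsto_of_tendsto_of_le_of_le tendsto_const_nhds hsymm
    (fun _ => zero_le) fun m => ?_⟩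
  simpa only [hRJ, zero_add] using
    measure_sdiff_le_add_symmDiff volume R (gapUnion (I (φ m))) (gapUnion J)

theorem tendsto_zero_of_natCast_mul_le {u : ℕ → ℝ≥0∞} {b : ℝ≥0∞} (hb : b ≠ ⊤)
    (hu : ∀ n : ℕ, n * u n ≤ b) : Tendsto u atTop (𝓝 0) := by
  have hlim : Tendsto (fun n : ℕ => b / n) atTop (𝓝 0) := by
    simpa using ENNReal.Tendsto.const_div ENNReal.tendsto_nat_nhds_top (Or.inr hb)
  refine tendsto_of_tendsto_of_tendsto_of_le_of_le' tendsto_const_nhds hlim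
    (.of_forall fun _ => zero_le) ?_
  filter_upwards [eventually_ne_atTop 0] with n hn
  rw [ENNReal.le_div_iff_mul_le (by simp [hn]) (by simp), mul_comm]
  exact hu n

theorem exists_forall_mul_volume_sdiff_gapUnion_le (hmono : Monotone h)
    (hlsc : LowerSemicontinuous h) (hdiv : Tendsto (fun t => h t / t) (𝓝[>] 0) atTop)
    (hR : volume R ≠ ⊤)
    (H : ∀ I, IsGapFamily I → gapSum h I ≠ ⊤ → volume (P \ gapUnion I) = 0 →
      volume (R \ gapUnion I) = 0) (c : ℝ≥0) :
    ∃ M : ℝ≥0, ∀ I, IsGapFamily I → (gapLength I).support.Finite →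
      c * volume (R \ gapUnion I) ≤ gapSum h I + M * volume (P \ gapUnion I) := by
  by_contra! hcon
  choose I hI hfin hlt using fun m : ℕ => hcon m
  have hcR : (c : ℝ≥0∞) * volume R ≠ ⊤ := ENNReal.mul_ne_top ENNReal.coe_ne_top hR
  have hbound : ∀ m, gapSum h (I m) + m * volume (P \ gapUnion (I m)) ≤ c * volume R :=
    fun m => (hlt m).le.trans (by gcongr; exact sdiff_subset)
  have hP : Tendsto (fun m => volume (P \ gapUnion (I m))) atTop (𝓝 0) :=
    tendsto_zero_of_natCast_mul_le hcR fun m => le_add_self.trans (hbound m)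
  obtain ⟨φ, -, hRφ⟩ := exists_subseq_tendsto_volume_sdiff_gapUnion hmono hlsc hdiv H hcR hI hfin
    (fun m => le_self_add.trans (hbound m)) hP
  obtain ⟨C, hC, hCh⟩ := exists_forall_ofReal_le_mul_of_le_one hmono hdiv
  have hsum : ∀ m, volume R ≤
      volume (R \ gapUnion (I (φ m))) + C * (c * volume (R \ gapUnion (I (φ m)))) := fun m =>
    calc volume R
        ≤ volume (R \ gapUnion (I (φ m))) + volume (gapUnion (I (φ m))) :=
          (measure_mono (subset_sdiff_union R _)).trans (measure_union_le _ _)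
      _ ≤ volume (R \ gapUnion (I (φ m))) + C * gapSum h (I (φ m)) := by
          gcongr
          exact (hI _).volume_gapUnion_le_mul hCh
      _ ≤ _ := by
          gcongr
          exact le_self_add.trans (hlt _).le
  have hR0 : volume R = 0 := by
    refine le_antisymm (ge_of_tendsto' (x := atTop) ?_ hsum) zero_le
    simpa using hRφ.add (ENNReal.Tendsto.const_mul
      (ENNReal.Tendsto.const_mul hRφ (Or.inr ENNReal.coe_ne_top)) (Or.inr hC))
  have hnull : volume (R \ gapUnion (I 0)) = 0 := measure_mono_null sdiff_subset hR0
  simpa [hnull] using hlt 0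

end ExactPenalty

section LeastCost

variable {α : Type*} [LinearOrder α]

/-- `x` is a subdivision `a = x 0 ≤ x 1 ≤ ⋯ ≤ x n = b`, continued by the constant value `b`. -/
structure IsSubdivision (x : ℕ → α) (n : ℕ) (a b : α) : Prop where
  monotone : Monotone x
  zero_eq : x 0 = a
  eq_of_ge : ∀ i ≥ n, x i = b

/-- The infimum, over all subdivisions of `[a, b]`, of the total cost of the steps, where a step
from `s` to `t` costs `k s t`. It is `∞` when `b < a`, as there are no subdivisions then. -/
noncomputable def leastCost (k : α → α → ℝ≥0∞) (a b : α) : ℝ≥0∞ :=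
  ⨅ (x : ℕ → α) (n : ℕ) (_ : IsSubdivision x n a b), ∑ i ∈ Finset.range n, k (x i) (x (i + 1))

variable {k : α → α → ℝ≥0∞} {x : ℕ → α} {n : ℕ} {a b b' : α}

theorem IsSubdivision.le_apply (hx : IsSubdivision x n a b) (i : ℕ) : a ≤ x i :=
  hx.zero_eq ▸ hx.monotone (Nat.zero_le i)

theorem IsSubdivision.apply_le (hx : IsSubdivision x n a b) (i : ℕ) : x i ≤ b :=
  hx.eq_of_ge (max i n) (le_max_right i n) ▸ hx.monotone (le_max_left i n)

theorem IsSubdivision.snoc (hx : IsSubdivision x n a b) (hb : b ≤ b') :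
    IsSubdivision (fun i => if i ≤ n then x i else b') (n + 1) a b' where
  monotone i j hij := by
    dsimp only
    split_ifs with hi hj
    · exact hx.monotone hij
    · exact (hx.apply_le i).trans hb
    · omega
    · exact le_rfl
  zero_eq := by simp [hx.zero_eq]
  eq_of_ge i hi := if_neg (by omega)

theorem IsSubdivision.min (hx : IsSubdivision x n a b') (hab : a ≤ b) (hb : b ≤ b') :
    IsSubdivision (fun i => min (x i) b) n a b where
  monotone _ _ hij := min_le_min_right b (hx.monotone hij)
  zero_eq := by simp [hx.zero_eq, hab]
  eq_of_ge i hi := by simp [hx.eq_of_ge i hi, hb]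

theorem IsSubdivision.biUnion_Ioc (hx : IsSubdivision x n a b) :
    ⋃ i ∈ Finset.range n, Ioc (x i) (x (i + 1)) = Ioc a b := by
  simpa [hx.zero_eq, hx.eq_of_ge n le_rfl] using hx.monotone.biUnion_Ico_Ioc_map_succ 0 n

theorem IsSubdivision.eq_apply_of_mem_Icc (hx : IsSubdivision x n a b) {i : ℕ} (hi : n ≤ i) {z : α}
    (hz : z ∈ Icc (x i) (x (i + 1))) : z = x i :=
  le_antisymm (hz.2.trans ((hx.apply_le _).trans_eq (hx.eq_of_ge i hi).symm)) hz.1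

theorem leastCost_le (hx : IsSubdivision x n a b) :
    leastCost k a b ≤ ∑ i ∈ Finset.range n, k (x i) (x (i + 1)) :=
  iInf_le_of_le x (iInf_le_of_le n (iInf_le_of_le hx le_rfl))

theorem le_leastCost {c : ℝ≥0∞}
    (hc : ∀ x n, IsSubdivision x n a b → c ≤ ∑ i ∈ Finset.range n, k (x i) (x (i + 1))) :
    c ≤ leastCost k a b :=
  le_iInf fun x => le_iInf fun n => le_iInf fun hx => hc x n hx

theorem leastCost_self (k : α → α → ℝ≥0∞) (a : α) : leastCost k a a = 0 := by
  have hconst : IsSubdivision (fun _ => a) 0 a a := ⟨monotone_const, rfl, fun _ _ => rfl⟩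
  simpa using leastCost_le (k := k) hconst

theorem leastCost_le_add (k : α → α → ℝ≥0∞) (a : α) (hb : b ≤ b') :
    leastCost k a b' ≤ leastCost k a b + k b b' := by
  simp only [leastCost, ENNReal.iInf_add]
  refine le_iInf fun x => le_iInf fun n => le_iInf fun hx => ?_
  refine (leastCost_le (hx.snoc hb)).trans_eq ?_
  rw [Finset.sum_range_succ]
  congr 1
  · refine Finset.sum_congr rfl fun i hi => ?_
    have hin := Finset.mem_range.1 hi
    rw [if_pos hin.le, if_pos (Nat.succ_le_of_lt hin)]
  · simp [hx.eq_of_ge n le_rfl]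

theorem leastCost_ne_top (hab : a ≤ b) (hk : k a b ≠ ⊤) : leastCost k a b ≠ ⊤ :=
  ne_top_of_le_ne_top hk <| (leastCost_le_add k a hab).trans_eq (by rw [leastCost_self, zero_add])

theorem toReal_leastCost_sub_le (hb : b ≤ b') (hfin : leastCost k a b ≠ ⊤) {d : ℝ≥0∞}
    (hd : d ≠ ⊤) (hkd : k b b' ≤ d) :
    (leastCost k a b').toReal - (leastCost k a b).toReal ≤ d.toReal := by
  rw [sub_le_iff_le_add', ← ENNReal.toReal_add hfin hd]
  exact ENNReal.toReal_mono (ENNReal.add_ne_top.2 ⟨hfin, hd⟩)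
    ((leastCost_le_add k a hb).trans (by gcongr))

theorem leastCost_mono (hself : ∀ s, k s s = 0) (hk : ∀ s, Monotone (k s)) (hab : a ≤ b)
    (hb : b ≤ b') : leastCost k a b ≤ leastCost k a b' := by
  refine le_leastCost fun x n hx => (leastCost_le (hx.min hab hb)).trans ?_
  refine Finset.sum_le_sum fun i _ => ?_
  rcases le_total (x i) b with hxi | hxi
  · rw [min_eq_left hxi]
    exact hk _ (min_le_left _ _)
  · rw [min_eq_right hxi, min_eq_right (hxi.trans (hx.monotone i.le_succ)), hself]
    exact zero_le

end LeastCost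

section StepCost

variable {h : ℝ → ℝ} {μ ν : Measure ℝ}

/-- The cheaper of two ways to pass from `x` to `y`: pay the `μ`-measure of the interval, or pay
`h` of its length together with its `ν`-measure. -/
noncomputable def stepCost (h : ℝ → ℝ) (μ ν : Measure ℝ) (x y : ℝ) : ℝ≥0∞ :=
  min (μ (Ioc x y)) (ENNReal.ofReal (h (y - x)) + ν (Ioc x y))

theorem stepCost_self (h : ℝ → ℝ) (μ ν : Measure ℝ) (x : ℝ) : stepCost h μ ν x x = 0 := by
  simp [stepCost]

theorem stepCost_mono (hmono : Monotone h) (μ ν : Measure ℝ) (x : ℝ) :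
    Monotone (stepCost h μ ν x) := by
  intro y y' hy
  have hIoc : Ioc x y ⊆ Ioc x y' := Ioc_subset_Ioc_right hy
  exact min_le_min (measure_mono hIoc) (add_le_add
    (ENNReal.ofReal_le_ofReal (hmono (sub_le_sub_right hy x))) (measure_mono hIoc))

theorem exists_gap_le_stepCost [NullSingletonClass μ] (h0 : h 0 = 0) {x y : ℝ} (hxy : x ≤ y) :
    ∃ z ∈ Icc x y, ENNReal.ofReal (h (z - x)) + μ (Ioc x y \ Ioo x z) + ν (Ioo x z) ≤
      stepCost h μ ν x y := by
  rcases le_total (μ (Ioc x y)) (ENNReal.ofReal (h (y - x)) + ν (Ioc x y)) with hle | hle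
  · exact ⟨x, left_mem_Icc.2 hxy, by simp [stepCost, hle, h0]⟩
  · refine ⟨y, right_mem_Icc.2 hxy, ?_⟩
    have hnull : μ (Ioc x y \ Ioo x y) = 0 := (ae_eq_set.1 Ioo_ae_eq_Ioc).2
    rw [stepCost, min_eq_right hle, hnull, add_zero]
    gcongr
    exact Ioo_subset_Ioc_self

theorem IsSubdivision.isGapFamily {x z : ℕ → ℝ} {n : ℕ} (hx : IsSubdivision x n 0 1)
    (hz : ∀ i, z i ∈ Icc (x i) (x (i + 1))) : IsGapFamily fun i => (x i, z i) where
  nonneg_fst := hx.le_apply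
  fst_le_snd i := (hz i).1
  snd_le_one i := (hz i).2.trans (hx.apply_le _)
  disjoint _ _ hij := (hx.monotone.pairwise_disjoint_on_Ioo_succ hij).mono
    (Ioo_subset_Ioo_right (hz _).2) (Ioo_subset_Ioo_right (hz _).2)

theorem IsSubdivision.exists_isGapFamily_le_sum_stepCost [NullSingletonClass μ] (h0 : h 0 = 0)
    {x : ℕ → ℝ} {n : ℕ} (hx : IsSubdivision x n 0 1) :
    ∃ I, IsGapFamily I ∧ (gapLength I).support.Finite ∧
      gapSum h I + μ (Ioc 0 1 \ gapUnion I) + ν (gapUnion I) ≤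
        ∑ i ∈ Finset.range n, stepCost h μ ν (x i) (x (i + 1)) := by
  choose z hz hcost using fun i =>
    exists_gap_le_stepCost (h := h) (μ := μ) (ν := ν) h0 (hx.monotone (Nat.le_succ i))
  have hlast : ∀ i ≥ n, z i = x i := fun i hi => hx.eq_apply_of_mem_Icc hi (hz i)
  let I : ℕ → ℝ × ℝ := fun i => (x i, z i)
  have hsum : gapSum h I = ∑ i ∈ Finset.range n, ENNReal.ofReal (h (z i - x i)) :=
    tsum_eq_sum fun i hi => by
      simp [I, gapLength, hlast i (by simpa using hi), h0]
  have hunion : gapUnion I ⊆ ⋃ i ∈ Finset.range n, Ioo (x i) (z i) := by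
    refine iUnion_subset fun i t (ht : t ∈ Ioo (x i) (z i)) => ?_
    refine mem_biUnion (Finset.mem_range.2 ?_) ht
    by_contra! hi
    simp [hlast i hi] at ht
  have hcover : Ioc 0 1 \ gapUnion I ⊆
      ⋃ i ∈ Finset.range n, Ioc (x i) (x (i + 1)) \ Ioo (x i) (z i) := by
    rintro t ⟨ht, htU⟩
    obtain ⟨i, hi, hti⟩ := mem_iUnion₂.1 (hx.biUnion_Ioc ▸ ht)
    exact mem_biUnion hi ⟨hti, fun hmem => htU (mem_iUnion.2 ⟨i, hmem⟩)⟩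
  refine ⟨I, hx.isGapFamily hz, (finite_lt_nat n).subset fun i hi => ?_, ?_⟩
  · by_contra hin
    exact hi (sub_eq_zero.2 (hlast i (not_lt.1 hin)))
  · calc gapSum h I + μ (Ioc 0 1 \ gapUnion I) + ν (gapUnion I)
        ≤ ∑ i ∈ Finset.range n, ENNReal.ofReal (h (z i - x i)) +
            ∑ i ∈ Finset.range n, μ (Ioc (x i) (x (i + 1)) \ Ioo (x i) (z i)) +
              ∑ i ∈ Finset.range n, ν (Ioo (x i) (z i)) := by
          rw [hsum]
          gcongr
          · exact (measure_mono hcover).trans (measure_biUnion_finset_le _ _)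
          · exact (measure_mono hunion).trans (measure_biUnion_finset_le _ _)
      _ ≤ _ := by
          rw [← Finset.sum_add_distrib, ← Finset.sum_add_distrib]
          exact Finset.sum_le_sum fun i _ => hcost i

theorem measure_Ioc_le_leastCost_stepCost [NullSingletonClass μ] (h0 : h 0 = 0)
    (hpen : ∀ I, IsGapFamily I → (gapLength I).support.Finite →
      ν (Ioc 0 1 \ gapUnion I) ≤ gapSum h I + μ (Ioc 0 1 \ gapUnion I)) :
    ν (Ioc 0 1) ≤ leastCost (stepCost h μ ν) 0 1 := by
  refine le_leastCost fun x n hx => ?_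
  obtain ⟨I, hI, hfin, hle⟩ := hx.exists_isGapFamily_le_sum_stepCost (h := h) (μ := μ) (ν := ν) h0
  calc ν (Ioc 0 1) ≤ ν (Ioc 0 1 \ gapUnion I) + ν (gapUnion I) :=
        (measure_mono (subset_sdiff_union _ _)).trans (measure_union_le _ _)
    _ ≤ gapSum h I + μ (Ioc 0 1 \ gapUnion I) + ν (gapUnion I) := by
        gcongr
        exact hpen I hI hfin
    _ ≤ _ := hle

end StepCost

section Density

variable {F : ℝ → ℝ} {P : Set ℝ} {M : ℝ≥0}

theorem lipschitzWith_of_sub_le_mul_volume_real (hF : Monotone F)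
    (hFP : ∀ x y, x ≤ y → F y - F x ≤ M * volume.real (P ∩ Ioc x y)) : LipschitzWith M F := by
  refine .of_le_add_mul M fun x y => ?_
  rcases le_total x y with hxy | hxy
  · exact (hF hxy).trans (le_add_of_nonneg_right (by positivity))
  · have hle : volume.real (P ∩ Ioc y x) ≤ x - y :=
      (measureReal_mono inter_subset_right measure_Ioc_lt_top.ne).trans_eq
        (Real.volume_real_Ioc_of_le hxy)
    rw [Real.dist_eq, abs_of_nonneg (sub_nonneg.2 hxy), ← sub_le_iff_le_add']
    exact (hFP y x hxy).trans (by gcongr)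

theorem intervalIntegral_indicator_const (hP : MeasurableSet P) (r : ℝ) {x y : ℝ} (hxy : x ≤ y) :
    ∫ t in x..y, P.indicator (fun _ => r) t = r * volume.real (P ∩ Ioc x y) := by
  rw [intervalIntegral.integral_of_le hxy, setIntegral_indicator hP, setIntegral_const,
    smul_eq_mul, mul_comm, inter_comm]

theorem ae_deriv_le_indicator (hP : MeasurableSet P) (hF : ∀ᵐ t, DifferentiableAt ℝ F t)
    (hFP : ∀ x y, x ≤ y → F y - F x ≤ M * volume.real (P ∩ Ioc x y)) :
    ∀ᵐ t, deriv F t ≤ P.indicator (fun _ => (M : ℝ)) t := by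
  have hint : LocallyIntegrable (P.indicator fun _ => (M : ℝ)) volume :=
    (locallyIntegrable_const _).indicator hP
  have hmono : Monotone fun y => (∫ t in (0 : ℝ)..y, P.indicator (fun _ => (M : ℝ)) t) - F y := by
    intro x y hxy
    have hsub := intervalIntegral.integral_interval_sub_left
      (hint.integrableOn_isCompact (isCompact_uIcc (a := 0) (b := y))).intervalIntegrable
      (hint.integrableOn_isCompact (isCompact_uIcc (a := 0) (b := x))).intervalIntegrable
    rw [intervalIntegral_indicator_const hP _ hxy] at hsub
    linarith [hFP x y hxy]
  filter_upwards [LocallyIntegrable.ae_hasDerivAt_integral hint, hF] with t ht hFt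
  have hderiv := ((ht 0).sub hFt.hasDerivAt).deriv ▸ hmono.deriv_nonneg (x := t)
  exact sub_nonneg.1 hderiv

theorem exists_density_of_sub_le_mul_volume_real (hF : Monotone F) (hP : MeasurableSet P)
    (hFP : ∀ x y, x ≤ y → F y - F x ≤ M * volume.real (P ∩ Ioc x y)) :
    ∃ p : ℝ → ℝ, Measurable p ∧ (∀ t, 0 ≤ p t) ∧ (∀ t, p t ≤ M) ∧ (∀ t ∉ P, p t = 0) ∧
      ∀ x y, ∫ t in x..y, p t = F y - F x := by
  have hlip := lipschitzWith_of_sub_le_mul_volume_real hF hFP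
  refine ⟨P.indicator (deriv F), (measurable_deriv F).indicator hP,
    indicator_nonneg fun _ _ => hF.deriv_nonneg, fun t => ?_,
    fun t ht => indicator_of_notMem ht _, fun x y => ?_⟩
  · exact indicator_le' (fun _ _ => (le_abs_self _).trans (norm_deriv_le_of_lipschitz hlip))
      (fun _ _ => M.coe_nonneg) t
  · have hae : ∀ᵐ t, P.indicator (deriv F) t = deriv F t := by
      filter_upwards [ae_deriv_le_indicator hP hlip.ae_differentiableAt_real hFP] with t ht
      by_cases htP : t ∈ P
      · exact indicator_of_mem htP _
      · rw [indicator_of_notMem htP] at ht ⊢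
        exact le_antisymm hF.deriv_nonneg ht
    rw [intervalIntegral.integral_congr_ae (hae.mono fun t ht _ => ht)]
    exact hlip.lipschitzOnWith.absolutelyContinuousOnInterval.integral_deriv_eq_sub

end Density

section BalancedDensity

variable {h : ℝ → ℝ} {P R : Set ℝ}

theorem measurableSet_gapUnion (I : ℕ → ℝ × ℝ) : MeasurableSet (gapUnion I) :=
  (isOpen_iUnion fun _ => isOpen_Ioo).measurableSet

theorem exists_monotone_sub_le_stepCost {μ ν : Measure ℝ} [IsLocallyFiniteMeasure μ]
    [IsLocallyFiniteMeasure ν] [NullSingletonClass μ] (hmono : Monotone h) (h0 : h 0 = 0)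
    (hpen : ∀ I, IsGapFamily I → (gapLength I).support.Finite →
      ν (Ioc 0 1 \ gapUnion I) ≤ gapSum h I + μ (Ioc 0 1 \ gapUnion I)) :
    ∃ F : ℝ → ℝ, Monotone F ∧ (∀ x y, x ≤ y → F y - F x ≤ μ.real (Ioc x y)) ∧
      (∀ x y, 0 ≤ x → x ≤ y → F y - F x ≤ h (y - x) + ν.real (Ioc x y)) ∧
      ν.real (Ioc 0 1) ≤ F 1 - F 0 := by
  let L : ℝ → ℝ≥0∞ := leastCost (stepCost h μ ν) 0
  have hμ : ∀ x y, μ (Ioc x y) ≠ ⊤ := fun x y => measure_Ioc_lt_top.ne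
  have hν : ∀ x y, ν (Ioc x y) ≠ ⊤ := fun x y => measure_Ioc_lt_top.ne
  have hLtop : ∀ y, 0 ≤ y → L y ≠ ⊤ := fun y hy =>
    leastCost_ne_top hy (ne_top_of_le_ne_top (hμ 0 y) (min_le_left _ _))
  refine ⟨fun y => (L (max 0 y)).toReal, fun x y hxy => ?_, fun x y hxy => ?_,
    fun x y hx hxy => ?_, ?_⟩
  · exact ENNReal.toReal_mono (hLtop _ (le_max_left _ _)) (leastCost_mono (stepCost_self h μ ν)
      (stepCost_mono hmono μ ν) (le_max_left _ _) (max_le_max_left 0 hxy))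
  · refine toReal_leastCost_sub_le (max_le_max_left 0 hxy) (hLtop _ (le_max_left _ _)) (hμ x y)
      ((min_le_left _ _).trans (measure_mono fun t ht => ?_))
    have := ht.1
    have := ht.2
    grind
  · have hh : 0 ≤ h (y - x) := h0.symm.trans_le (hmono (sub_nonneg.2 hxy))
    have hle := toReal_leastCost_sub_le hxy (hLtop x hx)
      (ENNReal.add_ne_top.2 ⟨ENNReal.ofReal_ne_top, hν x y⟩) (min_le_right (μ (Ioc x y)) _)
    rw [ENNReal.toReal_add ENNReal.ofReal_ne_top (hν x y), ENNReal.toReal_ofReal hh,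
      ← measureReal_def] at hle
    simpa only [max_eq_right hx, max_eq_right (hx.trans hxy)] using hle
  · have hle := ENNReal.toReal_mono (hLtop 1 zero_le_one)
      (measure_Ioc_le_leastCost_stepCost h0 hpen)
    simpa [L, leastCost_self, measureReal_def] using hle

theorem exists_density_le_add (hmono : Monotone h) (h0 : h 0 = 0) (hlsc : LowerSemicontinuous h)
    (hdiv : Tendsto (fun t => h t / t) (𝓝[>] 0) atTop) (hP : MeasurableSet P)
    (H : ∀ I, IsGapFamily I → gapSum h I ≠ ⊤ → volume ((P ∩ Ioc 0 1) \ gapUnion I) = 0 →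
      volume ((R ∩ Ioc 0 1) \ gapUnion I) = 0) (c : ℝ≥0) :
    ∃ p : ℝ → ℝ, Measurable p ∧ (∀ t, 0 ≤ p t) ∧ (∃ M, ∀ t, p t ≤ M) ∧ (∀ t ∉ P, p t = 0) ∧
      (∀ x y, 0 ≤ x → x ≤ y → ∫ t in x..y, p t ≤ h (y - x) + c * volume.real (R ∩ Ioc x y)) ∧
      c * volume.real (R ∩ Ioc 0 1) ≤ ∫ t in (0 : ℝ)..1, p t := by
  have hR : volume (R ∩ Ioc 0 1) ≠ ⊤ := measure_ne_top_of_subset inter_subset_right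
    measure_Ioc_lt_top.ne
  obtain ⟨M, hM⟩ := exists_forall_mul_volume_sdiff_gapUnion_le hmono hlsc hdiv hR H c
  let μ : Measure ℝ := M • volume.restrict P
  let ν : Measure ℝ := c • volume.restrict R
  have : NullSingletonClass μ := ⟨fun t => by simp [μ]⟩
  have hμ : ∀ x y, μ.real (Ioc x y) = M * volume.real (P ∩ Ioc x y) := fun x y => by
    simp [μ, measureReal_restrict_apply, inter_comm]
  have hν : ∀ x y, ν.real (Ioc x y) = c * volume.real (R ∩ Ioc x y) := fun x y => by
    simp [ν, measureReal_restrict_apply, inter_comm]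
  have hpen : ∀ I, IsGapFamily I → (gapLength I).support.Finite →
      ν (Ioc 0 1 \ gapUnion I) ≤ gapSum h I + μ (Ioc 0 1 \ gapUnion I) := fun I hI hfin => by
    have hmeas : MeasurableSet (Ioc 0 1 \ gapUnion I) :=
      measurableSet_Ioc.diff (measurableSet_gapUnion I)
    have hswap : ∀ S : Set ℝ, (Ioc 0 1 \ gapUnion I) ∩ S = (S ∩ Ioc 0 1) \ gapUnion I := fun S => by
      rw [inter_comm, inter_sdiff_assoc]
    simpa only [μ, ν, Measure.smul_apply, Measure.restrict_apply hmeas, hswap, ENNReal.smul_def,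
      smul_eq_mul] using hM I hI hfin
  obtain ⟨F, hF, hFμ, hFν, hF1⟩ := exists_monotone_sub_le_stepCost hmono h0 hpen
  simp only [hμ, hν] at hFμ hFν hF1
  obtain ⟨p, hp, hp0, hpM, hpP, hpF⟩ := exists_density_of_sub_le_mul_volume_real hF hP hFμ
  exact ⟨p, hp, hp0, ⟨M, hpM⟩, hpP, fun x y => by simpa only [hpF] using hFν x y, by rwa [hpF]⟩

theorem intervalIntegrable_of_forall_abs_le {f : ℝ → ℝ} (hf : Measurable f) {B : ℝ}
    (hB : ∀ t, |f t| ≤ B) (x y : ℝ) : IntervalIntegrable f volume x y :=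
  (intervalIntegrable_const (c := B)).mono_fun' hf.aestronglyMeasurable (ae_of_all _ hB)

theorem intervalIntegral_const_mul_sub_indicator_const {p : ℝ → ℝ} {x y : ℝ}
    (hp : IntervalIntegrable p volume x y) (hR : MeasurableSet R) (θ c : ℝ) (hxy : x ≤ y) :
    ∫ t in x..y, (θ * p t - R.indicator (fun _ => c) t) =
      θ * (∫ t in x..y, p t) - c * volume.real (R ∩ Ioc x y) := by
  have hc : IntervalIntegrable (R.indicator fun _ => c) volume x y := by
    rw [intervalIntegrable_iff_integrableOn_Ioc_of_le hxy]
    exact (integrableOn_const measure_Ioc_lt_top.ne).indicator hR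
  rw [intervalIntegral.integral_sub (hp.const_mul θ) hc, intervalIntegral.integral_const_mul,
    intervalIntegral_indicator_const hR c hxy]

theorem exists_balanced_density (hmono : Monotone h) (h0 : h 0 = 0) (hlsc : LowerSemicontinuous h)
    (hdiv : Tendsto (fun t => h t / t) (𝓝[>] 0) atTop) (hP : MeasurableSet P)
    (hR : MeasurableSet R) (hPR : Disjoint P R)
    (H : ∀ I, IsGapFamily I → gapSum h I ≠ ⊤ → volume ((P ∩ Ioc 0 1) \ gapUnion I) = 0 →
      volume ((R ∩ Ioc 0 1) \ gapUnion I) = 0) (c : ℝ≥0) :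
    ∃ g : ℝ → ℝ, Measurable g ∧ (∃ B, ∀ t, |g t| ≤ B) ∧ (∀ t ∈ R, g t = -c) ∧
      (∀ t, t ∉ P → t ∉ R → g t = 0) ∧
      (∀ x y, 0 ≤ x → x ≤ y → ∫ t in x..y, g t ≤ h (y - x)) ∧ ∫ t in (0 : ℝ)..1, g t = 0 := by
  obtain ⟨p, hp, hp0, ⟨M, hpM⟩, hpP, hple, hmass⟩ :=
    exists_density_le_add hmono h0 hlsc hdiv hP H c
  let m : ℝ := c * volume.real (R ∩ Ioc 0 1)
  let θ : ℝ := m / ∫ t in (0 : ℝ)..1, p t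
  have hm : 0 ≤ m := by positivity
  have hθ0 : 0 ≤ θ := div_nonneg hm (hm.trans hmass)
  have hθ1 : θ ≤ 1 := div_le_one_of_le₀ hmass (hm.trans hmass)
  have hθ : θ * ∫ t in (0 : ℝ)..1, p t = m :=
    div_mul_cancel_of_imp fun hzero => le_antisymm (hmass.trans_eq hzero) hm
  have hp_abs : ∀ t, |p t| ≤ M := fun t => (abs_of_nonneg (hp0 t)).trans_le (hpM t)
  have hint : ∀ x y, x ≤ y → ∫ t in x..y, (θ * p t - R.indicator (fun _ => (c : ℝ)) t) =
      θ * (∫ t in x..y, p t) - c * volume.real (R ∩ Ioc x y) := fun x y hxy =>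
    intervalIntegral_const_mul_sub_indicator_const
      (intervalIntegrable_of_forall_abs_le hp hp_abs x y) hR θ c hxy
  refine ⟨fun t => θ * p t - R.indicator (fun _ => (c : ℝ)) t,
    (hp.const_mul θ).sub (measurable_const.indicator hR), ⟨M + c, fun t => ?_⟩, fun t ht => ?_,
    fun t htP htR => ?_, fun x y hx hxy => ?_, ?_⟩
  · refine (abs_sub _ _).trans (add_le_add ?_ ?_)
    · rw [abs_mul, abs_of_nonneg hθ0]
      exact (mul_le_of_le_one_left (abs_nonneg _) hθ1).trans (hp_abs t)
    · rw [abs_of_nonneg (indicator_nonneg (fun _ _ => c.coe_nonneg) t)]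
      exact indicator_le' (fun _ _ => le_rfl) (fun _ _ => c.coe_nonneg) t
  · simp [ht, hpP t (disjoint_right.1 hPR ht)]
  · simp [htR, hpP t htP]
  · have hθp : θ * (∫ t in x..y, p t) ≤ ∫ t in x..y, p t :=
      mul_le_of_le_one_left (intervalIntegral.integral_nonneg hxy fun t _ => hp0 t) hθ1
    rw [hint x y hxy]
    linarith [hple x y hx hxy]
  · rw [hint 0 1 zero_le_one, hθ, sub_self]

end BalancedDensity

section Arc

theorem isOpen_coe_image_Ioo (T a b : ℝ) : IsOpen ((fun t : ℝ => (t : AddCircle T)) '' Ioo a b) :=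
  QuotientAddGroup.isOpenMap_coe _ isOpen_Ioo

theorem injOn_coe_Ioc (T a : ℝ) [Fact (0 < T)] :
    InjOn (fun t : ℝ => (t : AddCircle T)) (Ioc a (a + T)) :=
  fun _ hx _ hy => (AddCircle.coe_eq_coe_iff_of_mem_Ioc hx hy).1

variable {T : ℝ} [hT : Fact (0 < T)] {F : Type*} [NormedAddCommGroup F] [NormedSpace ℝ F]
  {a b : ℝ} {J : Set ℝ}

theorem volume_addCircle_singleton (x : AddCircle T) : volume {x} = 0 := by
  rw [← Metric.closedBall_zero, AddCircle.volume_closedBall]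
  simp [hT.out.le]

theorem coe_image_ae_eq_coe_image_Ioo (h1 : Ioo a b ⊆ J) (h2 : J ⊆ Icc a b) :
    (fun t : ℝ => (t : AddCircle T)) '' J =ᵐ[volume]
      (fun t : ℝ => (t : AddCircle T)) '' Ioo a b := by
  refine ae_eq_set.2 ⟨measure_mono_null ?_ (measure_union_null
    (volume_addCircle_singleton (a : AddCircle T)) (volume_addCircle_singleton (b : AddCircle T))),
    by rw [sdiff_eq_empty.2 (image_mono h1), measure_empty]⟩
  rintro _ ⟨⟨t, ht, rfl⟩, htIoo⟩
  rcases (h2 ht).1.eq_or_lt with rfl | hat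
  · exact Or.inl rfl
  rcases (h2 ht).2.eq_or_lt with rfl | htb
  · exact Or.inr rfl
  exact (htIoo ⟨t, ⟨hat, htb⟩, rfl⟩).elim

theorem setIntegral_coe_image (hab : a ≤ b) (hb : b ≤ a + T) (h1 : Ioo a b ⊆ J) (h2 : J ⊆ Icc a b)
    (f : AddCircle T → F) :
    ∫ x in (fun t : ℝ => (t : AddCircle T)) '' J, f x = ∫ t in a..b, f t := by
  let π : ℝ → AddCircle T := fun t => t
  have hIoo : MeasurableSet (π '' Ioo a b) := (isOpen_coe_image_Ioo T a b).measurableSet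
  have hsub : Ioo a b ⊆ Ioc a (a + T) := fun t ht => ⟨ht.1, ht.2.le.trans hb⟩
  have hpre : Ioc a (a + T) ∩ π ⁻¹' (π '' Ioo a b) = Ioo a b := by
    rw [inter_comm, (injOn_coe_Ioc T a).preimage_image_inter hsub]
  calc ∫ x in π '' J, f x = ∫ x, (π '' Ioo a b).indicator f x := by
        rw [setIntegral_congr_set (coe_image_ae_eq_coe_image_Ioo h1 h2), integral_indicator hIoo]
    _ = ∫ t in Ioc a (a + T), (π ⁻¹' (π '' Ioo a b)).indicator (f ∘ π) t :=
        (AddCircle.integral_preimage T a _).symm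
    _ = ∫ t in a..b, f t := by
        rw [setIntegral_indicator (AddCircle.measurable_mk' hIoo), hpre,
          intervalIntegral.integral_of_le hab, integral_Ioc_eq_integral_Ioo]
        rfl

theorem volume_real_coe_image (hab : a ≤ b) (hb : b ≤ a + T) (h1 : Ioo a b ⊆ J)
    (h2 : J ⊆ Icc a b) : volume.real ((fun t : ℝ => (t : AddCircle T)) '' J) = b - a := by
  simpa using setIntegral_coe_image hab hb h1 h2 fun _ => (1 : ℝ)

end Arc

section Carleson

variable {h : ℝ → ℝ} {I : ℕ → ℝ × ℝ}

theorem gapUnion_subset_Ioc (hI : IsGapFamily I) : gapUnion I ⊆ Ioc 0 1 :=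
  iUnion_subset fun k _ ht => ⟨(hI.nonneg_fst k).trans_lt ht.1, ht.2.le.trans (hI.snd_le_one k)⟩

theorem IsGapFamily.isHCarleson_compl_image (hI : IsGapFamily I) (hh : ∀ t ∈ Icc 0 1, 0 ≤ h t)
    (hsum : gapSum h I ≠ ⊤) :
    IsHCarleson h ((fun t : ℝ => (t : UnitAddCircle)) '' gapUnion I)ᶜ := by
  let U : ℕ → Set UnitAddCircle := fun k =>
    (fun t : ℝ => (t : UnitAddCircle)) '' Ioo (I k).1 (I k).2
  have hUopen : ∀ k, IsOpen (U k) := fun k => isOpen_coe_image_Ioo 1 _ _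
  have hlen : ∀ k, (I k).2 ≤ (I k).1 + 1 := fun k => by
    linarith [hI.nonneg_fst k, hI.snd_le_one k]
  have hsub : ∀ k, Ioo (I k).1 (I k).2 ⊆ Ioc 0 (0 + 1) := fun k => by
    simpa only [zero_add] using (subset_iUnion _ k).trans (gapUnion_subset_Ioc hI)
  have hUdisj : Pairwise fun i j => Disjoint (U i) (U j) := fun i j hij =>
    disjoint_image_image fun s hs t ht hst =>
      disjoint_left.1 (hI.disjoint hij) hs (injOn_coe_Ioc 1 0 (hsub i hs) (hsub j ht) hst ▸ ht)
  have hUsum : Summable fun k => h (volume.real (U k)) := by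
    refine (ENNReal.summable_toReal hsum).congr fun k => ?_
    rw [ENNReal.toReal_ofReal (hh _ ⟨hI.gapLength_nonneg k, hI.gapLength_le_one k⟩), gapLength,
      volume_real_coe_image (hI.fst_le_snd k) (hlen k) le_rfl Ioo_subset_Icc_self]
  rw [gapUnion, image_iUnion]
  refine ⟨(isOpen_iUnion hUopen).isClosed_compl, range U,
    forall_mem_range.2 fun k => ⟨hUopen k, ?_⟩, ?_, by rw [compl_compl, sUnion_range], ?_⟩
  · exact ⟨_, _, _, hI.fst_le_snd k, hlen k, le_rfl, Ioo_subset_Icc_self, rfl⟩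
  · rintro _ ⟨i, rfl⟩ _ ⟨j, rfl⟩ hij
    exact hUdisj fun hk => hij (congrArg U hk)
  · refine (hUsum.comp_injective (rangeSplitting_injective U)).congr fun ℓ => ?_
    simp only [Function.comp_apply, apply_rangeSplitting]

theorem volume_coe_preimage_sdiff_gapUnion (hI : IsGapFamily I) {S : Set UnitAddCircle}
    (hS : MeasurableSet S) :
    volume (((fun t : ℝ => (t : UnitAddCircle)) ⁻¹' S ∩ Ioc 0 1) \ gapUnion I) =
      volume (S \ (fun t : ℝ => (t : UnitAddCircle)) '' gapUnion I) := by
  let π : ℝ → UnitAddCircle := fun t => t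
  have hpre : π ⁻¹' (π '' gapUnion I) ∩ Ioc 0 1 = gapUnion I := by
    have hinj := injOn_coe_Ioc 1 0
    rw [zero_add] at hinj
    exact hinj.preimage_image_inter (gapUnion_subset_Ioc hI)
  have himage : MeasurableSet (π '' gapUnion I) :=
    (QuotientAddGroup.isOpenMap_coe _ (isOpen_iUnion fun _ => isOpen_Ioo)).measurableSet
  rw [AddCircle.add_projection_respects_measure 1 0 (hS.diff himage), zero_add]
  congr 1
  nth_rewrite 1 [← hpre]
  ext t
  simp only [Set.mem_sdiff, mem_inter_iff, mem_preimage]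
  tauto

end Carleson

section ArcBound

variable {F : Type*} [NormedAddCommGroup F]

theorem intervalIntegral_coe_sub_intCast [NormedSpace ℝ F] (f : UnitAddCircle → F) (n : ℤ)
    (x y : ℝ) :
    ∫ t in (x - n)..(y - n), f t = ∫ t in x..y, f t := by
  rw [← intervalIntegral.integral_comp_sub_right (fun t : ℝ => f t) (n : ℝ)]
  have hn : ((n : ℝ) : UnitAddCircle) = 0 := (AddCircle.coe_eq_zero_iff 1).2 ⟨n, by simp⟩
  simp only [AddCircle.coe_sub, hn, sub_zero]

theorem intervalIntegrable_coe {f : UnitAddCircle → F} (hf : Integrable f) (x y : ℝ) :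
    IntervalIntegrable (fun t : ℝ => f t) volume x y := by
  have h01 : IntervalIntegrable (fun t : ℝ => f t) volume 0 (0 + 1) :=
    (intervalIntegrable_iff_integrableOn_Ioc_of_le (by simp)).2
      ((UnitAddCircle.measurePreserving_mk 0).integrable_comp_of_integrable hf)
  exact Function.Periodic.intervalIntegrable (T := 1) (fun t => by simp) one_ne_zero h01 x y

theorem IsArc.setIntegral_le_two_mul {h : ℝ → ℝ} {f : UnitAddCircle → ℝ} {Δ : Set UnitAddCircle}
    (hΔ : IsArc Δ) (hf : Integrable f) (hmono : Monotone h) (h0 : 0 ≤ h 0)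
    (hle : ∀ x y, 0 ≤ x → x ≤ y → y ≤ 1 → ∫ t in x..y, f t ≤ h (y - x)) :
    ∫ x in Δ, f x ≤ 2 * h (volume.real Δ) := by
  obtain ⟨a, b, J, hab, hb, h1, h2, rfl⟩ := hΔ
  rw [setIntegral_coe_image hab hb h1 h2, volume_real_coe_image hab hb h1 h2,
    ← intervalIntegral_coe_sub_intCast f ⌊a⌋, two_mul]
  obtain ⟨x, hx⟩ : ∃ x, x = a - ⌊a⌋ := ⟨_, rfl⟩
  obtain ⟨y, hy⟩ : ∃ y, y = b - ⌊a⌋ := ⟨_, rfl⟩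
  have hx0 : 0 ≤ x := hx ▸ sub_nonneg.2 (Int.floor_le a)
  have hx1 : x ≤ 1 := by linarith [Int.lt_floor_add_one a]
  have hxy : x ≤ y := by linarith
  rw [← hx, ← hy, show b - a = y - x by linarith]
  rcases le_total y 1 with hy1 | hy1
  · exact (hle x y hx0 hxy hy1).trans
      (le_add_of_nonneg_right (h0.trans (hmono (sub_nonneg.2 hxy))))
  calc ∫ t in x..y, f t = (∫ t in x..1, f t) + ∫ t in 0..(y - 1), f t := by
        rw [← intervalIntegral.integral_add_adjacent_intervals (intervalIntegrable_coe hf x 1)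
          (intervalIntegrable_coe hf 1 y), ← intervalIntegral_coe_sub_intCast f 1 1 y,
          Int.cast_one, sub_self]
    _ ≤ h (1 - x) + h (y - 1 - 0) :=
        add_le_add (hle x 1 hx0 hx1 le_rfl)
          (hle 0 (y - 1) le_rfl (by linarith) (by linarith))
    _ ≤ h (y - x) + h (y - x) := add_le_add (hmono (by linarith)) (hmono (by linarith))

end ArcBound

section CircleFunction

variable {h : ℝ → ℝ} {P R : Set UnitAddCircle}

theorem measurable_liftIoc {T : ℝ} [Fact (0 < T)] {β : Type*} [MeasurableSpace β] {g : ℝ → β}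
    (hg : Measurable g) (a : ℝ) : Measurable (AddCircle.liftIoc T a g) :=
  (hg.comp measurable_subtype_coe).comp (AddCircle.measurableEquivIoc T a).measurable

theorem exists_function_circle (hmono : Monotone h) (h0 : h 0 = 0) (hlsc : LowerSemicontinuous h)
    (hdiv : Tendsto (fun t => h t / t) (𝓝[>] 0) atTop) (hP : MeasurableSet P)
    (hR : MeasurableSet R) (hPR : Disjoint P R)
    (H : ∀ A, IsHCarleson h A → volume (P ∩ A) = 0 → volume (R ∩ A) = 0) (c : ℝ≥0) :
    ∃ f : UnitAddCircle → ℝ, Measurable f ∧ (∃ B, ∀ x, |f x| ≤ B) ∧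
      (∀ Δ, IsArc Δ → ∫ x in Δ, f x ≤ 2 * h (volume.real Δ)) ∧ ∫ x, f x = 0 ∧
      (∀ x ∈ R, f x = -c) ∧ ∀ x, x ∉ P → x ∉ R → f x = 0 := by
  let π : ℝ → UnitAddCircle := fun t => t
  have hπ : Measurable π := AddCircle.measurable_mk'
  have hgap : ∀ I, IsGapFamily I → gapSum h I ≠ ⊤ →
      volume ((π ⁻¹' P ∩ Ioc 0 1) \ gapUnion I) = 0 →
      volume ((π ⁻¹' R ∩ Ioc 0 1) \ gapUnion I) = 0 := fun I hI hsum => by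
    have hA := hI.isHCarleson_compl_image (fun t ht => h0.symm.trans_le (hmono ht.1)) hsum
    rw [volume_coe_preimage_sdiff_gapUnion hI hP, volume_coe_preimage_sdiff_gapUnion hI hR]
    exact H _ hA
  obtain ⟨g, hg, ⟨B, hB⟩, hgR, hg0, hgh, hgint⟩ :=
    exists_balanced_density hmono h0 hlsc hdiv (hπ hP) (hπ hR) (hPR.preimage π) hgap c
  let f : UnitAddCircle → ℝ := AddCircle.liftIoc 1 0 g
  have hf : Measurable f := measurable_liftIoc hg 0
  have hfB : ∀ x, |f x| ≤ B := fun x => hB _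
  have hfg : ∀ x y, 0 ≤ x → x ≤ y → y ≤ 1 → ∫ t in x..y, f t = ∫ t in x..y, g t :=
    fun x y hx hxy hy => intervalIntegral.integral_congr_ae (ae_of_all _ fun t ht => by
      rw [uIoc_of_le hxy] at ht
      exact AddCircle.liftIoc_zero_coe_apply ⟨hx.trans_lt ht.1, ht.2.trans hy⟩)
  have hrep : ∀ x, ∃ t, π t = x ∧ f x = g t := fun x =>
    ⟨AddCircle.equivIoc 1 0 x, AddCircle.coe_equivIoc, rfl⟩
  refine ⟨f, hf, ⟨B, hfB⟩, fun Δ hΔ => hΔ.setIntegral_le_two_mul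
    (Integrable.of_bound hf.aestronglyMeasurable B (ae_of_all _ hfB)) hmono h0.ge
    fun x y hx hxy hy => (hfg x y hx hxy hy).trans_le (hgh x y hx hxy), ?_, fun x hx => ?_,
    fun x hxP hxR => ?_⟩
  · rw [AddCircle.integral_liftIoc_eq_intervalIntegral, zero_add, hgint]
  · obtain ⟨t, rfl, hft⟩ := hrep x
    rw [hft, hgR t hx]
  · obtain ⟨t, rfl, hft⟩ := hrep x
    rw [hft, hg0 t hxP hxR]

end CircleFunction

section Decomposition

variable {h h' : ℝ → ℝ} {A E core res : Set UnitAddCircle}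

theorem exists_monotone_lowerSemicontinuous_eqOn_Icc {a b : ℝ} (hab : a ≤ b)
    (hlsc : LowerSemicontinuousOn h (Icc a b)) (hmono : MonotoneOn h (Icc a b)) :
    ∃ h' : ℝ → ℝ, LowerSemicontinuous h' ∧ Monotone h' ∧ EqOn h' h (Icc a b) :=
  ⟨IccExtend hab ((Icc a b).domRestrict h),
    (lowerSemicontinuous_restrict_iff.2 hlsc).comp continuous_projIcc,
    Monotone.IccExtend hab fun s t hst => hmono s.2 t.2 hst,
    fun _ ht => IccExtend_of_mem hab _ ht⟩

theorem volume_real_mem_Icc (A : Set UnitAddCircle) : volume.real A ∈ Icc 0 1 :=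
  ⟨measureReal_nonneg, (measureReal_mono (subset_univ A)).trans_eq (by simp [measureReal_def])⟩

theorem IsHCarleson.congr (hA : IsHCarleson h A) (hh : EqOn h h' (Icc 0 1)) : IsHCarleson h' A :=
  let ⟨hclosed, L, hL, hdisj, hunion, hsum⟩ := hA
  ⟨hclosed, L, hL, hdisj, hunion, hsum.congr fun ℓ => hh (volume_real_mem_Icc ℓ.1)⟩

theorem exists_function_circle_of_monotoneOn {P R : Set UnitAddCircle}
    (hmono : MonotoneOn h (Icc 0 1)) (h0 : h 0 = 0) (hlsc : LowerSemicontinuousOn h (Icc 0 1))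
    (hdiv : Tendsto (fun t => h t / t) (𝓝[>] 0) atTop) (hP : MeasurableSet P)
    (hR : MeasurableSet R) (hPR : Disjoint P R)
    (H : ∀ A, IsHCarleson h A → volume (P ∩ A) = 0 → volume (R ∩ A) = 0) (c : ℝ≥0) :
    ∃ f : UnitAddCircle → ℝ, Measurable f ∧ (∃ B, ∀ x, |f x| ≤ B) ∧
      (∀ Δ, IsArc Δ → ∫ x in Δ, f x ≤ 2 * h (volume.real Δ)) ∧ ∫ x, f x = 0 ∧
      (∀ x ∈ R, f x = -c) ∧ ∀ x, x ∉ P → x ∉ R → f x = 0 := by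
  obtain ⟨h', hlsc', hmono', hh'⟩ :=
    exists_monotone_lowerSemicontinuous_eqOn_Icc zero_le_one hlsc hmono
  have hdiv' : Tendsto (fun t => h' t / t) (𝓝[>] 0) atTop := hdiv.congr' <| by
    filter_upwards [Ioc_mem_nhdsGT zero_lt_one] with t ht
    rw [hh' (Ioc_subset_Icc_self ht)]
  obtain ⟨f, hf, hfB, hfΔ, hf0⟩ := exists_function_circle hmono'
    ((hh' (left_mem_Icc.2 zero_le_one)).trans h0) hlsc' hdiv' hP hR hPR
    (fun A hA => H A (hA.congr hh')) c
  exact ⟨f, hf, hfB, fun Δ hΔ => hh' (volume_real_mem_Icc Δ) ▸ hfΔ Δ hΔ, hf0⟩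

theorem IsCoreResidual.almostContained_core (hcr : IsCoreResidual h E core res)
    (hA : IsHCarleson h A) (hAE : AlmostContained A (res ∪ core)) : AlmostContained A core := by
  obtain ⟨N, hN, rfl⟩ := hcr.decomp
  refine hcr.carleson_subset A hA (measure_mono_null ?_ (measure_union_null hAE hN))
  intro x hx
  simp only [Set.mem_sdiff, Set.mem_union] at hx ⊢
  tauto

theorem mainTheorem9_general (hlsc : LowerSemicontinuousOn h (Icc 0 1))
    (hmono : MonotoneOn h (Icc 0 1)) (h0 : h 0 = 0)
    (hdiv : Tendsto (fun t => h t / t) (𝓝[>] 0) atTop) (hcore : NullMeasurableSet core)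
    (hres : NullMeasurableSet res) (hdisj : Disjoint res core)
    (hmax : ∀ A, IsHCarleson h A → AlmostContained A (res ∪ core) → AlmostContained A core) :
    ∃ f : ℕ → UnitAddCircle → ℝ,
      (∀ n, Measurable (f n) ∧ ∃ B : ℝ, ∀ x, |f n x| ≤ B) ∧
      (∀ n, ∀ Δ : Set UnitAddCircle, IsArc Δ → ∫ x in Δ, f n x ≤ 2 * h (volume.real Δ)) ∧
      (∀ n, ∫ x, f n x = 0) ∧
      (∀ n, ∀ᵐ x, x ∈ core → f n x = 0) ∧
      (∀ n, ∀ᵐ x, x ∈ res → f n x ≤ 0) ∧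
      (∃ Z : Set UnitAddCircle, volume Z = 0 ∧
        ∀ M : ℝ, ∃ n₀ : ℕ, ∀ n ≥ n₀, ∀ x ∈ res \ Z, f n x ≤ M) := by
  obtain ⟨P, hPsub, hP, hPae⟩ := (hres.union hcore).compl.exists_measurable_subset_ae_eq
  obtain ⟨R, hRsub, hR, hRae⟩ := hres.exists_measurable_subset_ae_eq
  have hPR : Disjoint P R := disjoint_left.2 fun x hxP hxR => hPsub hxP (Or.inl (hRsub hxR))
  have hcarleson : ∀ A, IsHCarleson h A → volume (P ∩ A) = 0 → volume (R ∩ A) = 0 := by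
    intro A hA hPA
    have hAE : AlmostContained A (res ∪ core) := by
      rwa [AlmostContained, sdiff_eq, inter_comm, ← measure_congr (hPae.inter (ae_eq_refl A))]
    have hRA : R ∩ A ⊆ A \ core := fun x hx => ⟨hx.2, disjoint_left.1 hdisj (hRsub hx.1)⟩
    exact measure_mono_null hRA (hmax A hA hAE)
  choose f hf hfB hfΔ hf0 hfR hfPR using fun n : ℕ =>
    exists_function_circle_of_monotoneOn hmono h0 hlsc hdiv hP hR hPR hcarleson n
  have hnull : volume (res \ R) = 0 := (ae_eq_set.1 hRae).2
  refine ⟨f, fun n => ⟨hf n, hfB n⟩, hfΔ, hf0, fun n => ae_of_all _ fun x hx => ?_,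
    fun n => ?_, res \ R, hnull, fun M => ?_⟩
  · exact hfPR n x (fun hxP => hPsub hxP (Or.inr hx)) fun hxR =>
      disjoint_left.1 hdisj (hRsub hxR) hx
  · filter_upwards [measure_eq_zero_iff_ae_notMem.1 hnull] with x hx hxr
    rw [hfR n x (by_contra fun hxR => hx ⟨hxr, hxR⟩)]
    simp
  · obtain ⟨n₀, hn₀⟩ := exists_nat_ge (-M)
    refine ⟨n₀, fun n hn x hx => ?_⟩
    rw [hfR n x (by_contra fun hxR => hx.2 ⟨hx.1, hxR⟩), NNReal.coe_natCast]
    have hn' : (n₀ : ℝ) ≤ n := Nat.cast_le.2 hn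
    linarith

end Decomposition

theorem mainTheorem9 (h : ℝ → ℝ) (hh : IsMeasureFunction h)
    (E : Set UnitAddCircle) (hE : NullMeasurableSet E volume)
    (core res : Set UnitAddCircle) (hcr : IsCoreResidual h E core res) :
    ∃ f : ℕ → UnitAddCircle → ℝ,
      (∀ n, Measurable (f n) ∧ ∃ B : ℝ, ∀ x, |f n x| ≤ B) ∧
      (∀ n, ∀ Δ : Set UnitAddCircle, IsArc Δ → ∫ x in Δ, f n x ≤ 2 * h (volume.real Δ)) ∧
      (∀ n, ∫ x, f n x = 0) ∧
      (∀ n, ∀ᵐ x, x ∈ core → f n x = 0) ∧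
      (∀ n, ∀ᵐ x, x ∈ res → f n x ≤ 0) ∧
      (∃ Z : Set UnitAddCircle, volume Z = 0 ∧
        ∀ M : ℝ, ∃ n₀ : ℕ, ∀ n ≥ n₀, ∀ x ∈ res \ Z, f n x ≤ M) :=
  mainTheorem9_general hh.continuousOn.lowerSemicontinuousOn hh.monotoneOn hh.map_zero
    hh.tendsto_div hcr.measurable_core hcr.measurable_res hcr.disjoint
    fun _ => hcr.almostContained_core
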